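/- A \emph{scheduling problem} on $n$ items is a boolean formula $S$ over atomic formulas $x_i\le x_j$, $i,j\in[n]$; write $x_i<x_j$ for $\neg(x_j\le x_i)$. Two formulas are \emph{equivalent} if they have the same solutions $x\in\mathbb R^n$. For an ordered set partition $\Phi=(\Phi_1|\cdots|\Phi_\ell)$ of $[n]$ let $\sigma_\Phi$ be the relatively open simplex of all $x\in(0,1)^n$ that are constant on each block $\Phi_k$ and whose value on $\Phi_k$ is smaller than its value on $\Phi_{k+1}$ for every $k<\ell$; it has dimension $\ell$, and its $\ell+1$ vertices are the $0/1$-vectors of the sets $\Phi_{k+1}\cup\dots\cup\Phi_\ell$, $0\le k\le\ell$. Say that $S(\Phi)$ holds if all positive integer vectors with the relative order given by $\Phi$ satisfy $S$. The \emph{allowed configuration} is $\mathrm{Allow}(S)=\{\sigma_\Phi : S(\Phi)\text{ holds}\}$, regarded as a partial simplicial complex (a set of nonempty faces of a simplicial complex that contains all its maximal faces); the ambient simplicial complex consists of all nonempty faces of the closures of these $\sigma_\Phi$. A partial simplicial complex, all of whose maximal faces have dimension $d$, is \emph{partitionable} (in dimension $d$) if the union of its relatively open faces is a disjoint union of half-open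 $d$-dimensional simplices, where a half-open simplex is obtained from a closed $d$-dimensional simplex of the ambient simplicial complex by removing some (possibly none or all) of its facets. The \emph{dimension} of a conjunction of inequalities is the dimension of the polyhedron of all its solutions in $\mathbb R^n$. A formula $C$ is \emph{almost open} if it is equivalent to a conjunction of inequalities of the form $x_i\le x_j$ or $x_i<x_j$, at most one of which is weak ($\le$), and each of which defines a facet of the polyhedron of solutions of $C$ (that is, the face of the closure of the polyhedron on which the inequality is tight has dimension one less than the polyhedron). \textbf{Lemma.} Let $C$ be a conjunction of inequalities of the form $x_i\le x_j$ or $x_i<x_j$. If $C$ is almost open of dimension $d$, then $\mathrm{Allow}(C)$ is partitionable in dimension $d$. \textbf{Theorem.} Let $S$ be a scheduling problem that is equivalent to a finite disjunction $\bigvee_i C_i$ of conjunctions $C_i=\bigwedge_j I_{i,j}$ of inequalities of the form $x_i\le x_j$ or $x_i<x_j$. Suppose that the disjunction is disjoint, i.e. every $x\in\mathbb R^n$ satisfies at most one of the $C_i$, and that all $C_i$ are almost open of the same dimension $d$. Then $\mathrm{Allow}(S)$ is partitionable in dimension $d$. -/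

import Mathlib

open Set Finset

noncomputable section

namespace Scheduling

/-! ### Scheduling problems and ordered set partitions -/

/-- A scheduling problem on `n` items: a boolean formula over atoms `x i ≤ x j`. -/
inductive Problem (n : ℕ) : Type
  | atom (i j : Fin n) : Problem n
  | false : Problem n
  | not (S : Problem n) : Problem n
  | and (S T : Problem n) : Problem n
  | or (S T : Problem n) : Problem n

/-- Truth of a scheduling problem at a point (real points and integer schedules alike). -/
def Problem.Holds {n : ℕ} {α : Type*} [LE α] (x : Fin n → α) : Problem n → Prop
  | .atom i j => x i ≤ x j
  | .false => False
  | .not S => ¬ Holds x S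
  | .and S T => Holds x S ∧ Holds x T
  | .or S T => Holds x S ∨ Holds x T

/-- The set of all real points satisfying the formula. -/
def Problem.solutionSet {n : ℕ} (S : Problem n) : Set (Fin n → ℝ) := {x | S.Holds x}

/-- Two formulas are equivalent if they have the same solutions. -/
def Problem.Equiv {n : ℕ} (S T : Problem n) : Prop := S.solutionSet = T.solutionSet

/-- The disjunction `S 0 ∨ S 1 ∨ ⋯` of a list of formulas. -/
def Problem.disj {n : ℕ} : List (Problem n) → Problem n
  | [] => .false
  | S :: L => .or S (Problem.disj L)

/-- An inequality `x lhs ≤ x rhs` (weak) or `x lhs < x rhs` (strict). -/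
structure Ineq (n : ℕ) where
  lhs : Fin n
  rhs : Fin n
  weak : Bool

/-- An inequality as a formula; `x i < x j` is the negation of `x j ≤ x i`. -/
def Ineq.toProblem {n : ℕ} (I : Ineq n) : Problem n :=
  if I.weak then .atom I.lhs I.rhs else .not (.atom I.rhs I.lhs)

/-- The conjunction of a list of inequalities (the empty conjunction is true). -/
def conj {n : ℕ} : List (Ineq n) → Problem n
  | [] => .not .false
  | I :: L => .and I.toProblem (conj L)

/-- An ordered set partition of `[n]`: the `k`-th block is the set of all `i` with `index i = k`.
Blocks are nonempty by surjectivity, and are automatically disjoint with union `[n]`. -/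
structure OrderedSetPartition (n : ℕ) where
  length : ℕ
  index : Fin n → Fin length
  surj : Function.Surjective index

/-- `Δ(a) = Φ`: the point `a` is constant on the blocks of `Φ` and increases from one block to
the next. -/
def OrderedSetPartition.IsOrderOf {n : ℕ} (Φ : OrderedSetPartition n) {α : Type*} [LT α]
    (a : Fin n → α) : Prop :=
  (∀ i j, Φ.index i = Φ.index j → a i = a j) ∧ (∀ i j, Φ.index i < Φ.index j → a i < a j)

/-- `Φ` solves `S`, written `S(Φ)`: all schedules (positive integer vectors) whose
relative order is `Φ` solve `S`. -/
def Problem.SolvedBy {n : ℕ} (S : Problem n) (Φ : OrderedSetPartition n) : Prop :=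
  ∀ a : Fin n → ℕ, (∀ i, 1 ≤ a i) → Φ.IsOrderOf a → S.Holds a

/-! ### Almost open formulas -/

open Classical in
/-- The dimension of a convex set `X ⊆ ℝⁿ`, i.e. of its affine hull; `⊥` for the empty set. -/
def dim {n : ℕ} (X : Set (Fin n → ℝ)) : WithBot ℕ :=
  if X.Nonempty then ((Module.finrank ℝ (vectorSpan ℝ X) : ℕ) : WithBot ℕ) else ⊥

/-- The inequality `I` defines a facet of the polyhedron `P` (some of whose faces may be
missing): `I` is valid on `P`, and the face of the closure of `P` on which `I` is tight has
codimension one in `P`. -/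
def Ineq.FacetDefining {n : ℕ} (I : Ineq n) (P : Set (Fin n → ℝ)) : Prop :=
  P ⊆ I.toProblem.solutionSet ∧
    ∃ k : ℕ, dim P = ((k + 1 : ℕ) : WithBot ℕ) ∧
      dim (closure P ∩ {x | x I.lhs = x I.rhs}) = (k : WithBot ℕ)

/-- A formula is almost open if it is equivalent to a conjunction of inequalities, at most one of
which is weak and all of which are facet-defining. -/
def Problem.AlmostOpen {n : ℕ} (C : Problem n) : Prop :=
  ∃ L : List (Ineq n), C.Equiv (conj L) ∧ (L.filter (fun I => I.weak)).length ≤ 1 ∧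
    ∀ I ∈ L, I.FacetDefining C.solutionSet

/-! ### Partial simplicial complexes and partitionability -/

section Partial

variable {E : Type*} [AddCommGroup E] [Module ℝ E]

/-- The half-open simplex with vertex set `u` from which, for every `v ∈ l`, the facet opposite
to `v` is removed: all convex combinations of `u` with positive weights on `l`. -/
def halfOpenSimplex (l u : Finset E) : Set E :=
  {x | ∃ w : E → ℝ, (∀ v ∈ u, 0 ≤ w v) ∧ (∀ v ∈ l, 0 < w v) ∧
    ∑ v ∈ u, w v = 1 ∧ ∑ v ∈ u, w v • v = x}

/-- The relatively open simplex with vertex set `s`. -/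
def openSimplex (s : Finset E) : Set E := halfOpenSimplex s s

variable (E) in
/-- A (geometric) partial simplicial complex: a simplicial complex together with a set of its
nonempty faces containing all the maximal faces.  Faces are given by their vertex sets. -/
structure PartialComplex where
  closed : Geometry.SimplicialComplex ℝ E
  faces : Set (Finset E)
  faces_subset : faces ⊆ closed.faces
  facets_subset : closed.facets ⊆ faces

/-- The underlying point set: the union of the relatively open simplices of all faces. -/
def PartialComplex.space (K : PartialComplex E) : Set E := ⋃ s ∈ K.faces, openSimplex s

/-- All maximal faces have dimension `d`. -/
def PartialComplex.IsPure (K : PartialComplex E) (d : ℕ) : Prop :=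
  ∀ s ∈ K.closed.facets, s.card = d + 1

/-- `K` is pure of dimension `d` and is a disjoint union of half-open `d`-dimensional simplices
of the complex. -/
def PartialComplex.Partitionable (K : PartialComplex E) (d : ℕ) : Prop :=
  K.IsPure d ∧ ∃ P : Set (Finset E × Finset E),
    (∀ p ∈ P, p.1 ⊆ p.2 ∧ p.2 ∈ K.closed.faces ∧ p.2.card = d + 1) ∧
    P.PairwiseDisjoint (fun p => halfOpenSimplex p.1 p.2) ∧
    ⋃ p ∈ P, halfOpenSimplex p.1 p.2 = K.space

end Partial

/-! ### The braid triangulation of the open cube -/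

namespace OrderedSetPartition

variable {n : ℕ} (Φ : OrderedSetPartition n)

/-- The `k`-th vertex of the simplex of `Φ`: the `0/1`-vector of the union of the blocks with
index at least `k`, for `k = 0, …, length`. -/
def vertex (k : Fin (Φ.length + 1)) : Fin n → ℝ :=
  fun i => if k ≤ (Φ.index i).castSucc then 1 else 0

open Classical in
/-- The vertex set of the face `σ_Φ` of the braid triangulation of the open cube `(0,1)ⁿ`
(see `openSimplex_vertices`). -/
def vertices : Finset (Fin n → ℝ) := Finset.univ.image Φ.vertex

lemma vertex_injective : Function.Injective Φ.vertex := by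
  have key : ∀ k l, k < l → Φ.vertex k ≠ Φ.vertex l := by
    intro k l hkl h
    obtain ⟨i, hi⟩ := Φ.surj ⟨k.1, by have := l.2; have : k.1 < l.1 := hkl; omega⟩
    have := congrFun h i
    simp only [vertex, hi] at this
    have h1 : k ≤ Fin.castSucc ⟨k.1, by have := l.2; have : k.1 < l.1 := hkl; omega⟩ := le_refl k
    have h2 : ¬ l ≤ Fin.castSucc ⟨k.1, by have := l.2; have : k.1 < l.1 := hkl; omega⟩ :=
      not_le.2 hkl
    rw [if_pos h1, if_neg h2] at this
    exact one_ne_zero this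
  intro k l h
  rcases lt_trichotomy k l with hkl | hkl | hkl
  · exact (key _ _ hkl h).elim
  · exact hkl
  · exact (key _ _ hkl h.symm).elim

lemma card_vertices : Φ.vertices.card = Φ.length + 1 := by
  classical
  rw [vertices, Finset.card_image_of_injective _ Φ.vertex_injective]
  simp

/-- Coordinates of a combination of the vertices. -/
lemma sum_vertex_apply (W : Fin (Φ.length + 1) → ℝ) (i : Fin n) :
    (∑ k, W k • Φ.vertex k) i = ∑ k ∈ Finset.Iic (Φ.index i).castSucc, W k := by
  rw [Finset.sum_apply]
  simp only [vertex, Pi.smul_apply, smul_eq_mul, mul_ite, mul_one, mul_zero]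
  rw [← Finset.sum_filter]
  congr 1
  ext k
  simp

lemma affineIndependent_vertex : AffineIndependent ℝ Φ.vertex := by
  rw [affineIndependent_iff]
  intro s w hw hs
  classical
  set W : Fin (Φ.length + 1) → ℝ := fun k => if k ∈ s then w k else 0 with hW
  have h1 : ∑ k, W k = 0 := by
    simpa [hW, Finset.sum_ite_mem] using hw
  have h2 : ∑ k, W k • Φ.vertex k = 0 := by
    rw [← hs]
    simp [hW, ite_smul, Finset.sum_ite_mem]
  have h3 : ∀ j : Fin (Φ.length + 1), ∑ k ∈ Finset.Iic j, W k = 0 := by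
    intro j
    induction j using Fin.lastCases with
    | last =>
      rw [← h1]
      congr 1
      ext k
      simp [Fin.le_last]
    | cast j =>
      obtain ⟨i, rfl⟩ := Φ.surj j
      rw [← Φ.sum_vertex_apply, h2]
      rfl
  have h4 : ∀ j, W j = 0 := by
    intro j
    induction j using WellFoundedLT.induction with
    | ind j ih =>
      have := h3 j
      rw [← Finset.Iio_insert, Finset.sum_insert (by simp),
        Finset.sum_eq_zero (fun k hk => ih k (Finset.mem_Iio.1 hk)), add_zero] at this
      exact this
  intro k hk
  simpa [hW, hk] using h4 k

lemma affineIndependent_vertices {s : Finset (Fin n → ℝ)} (hs : s ⊆ Φ.vertices) :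
    AffineIndependent ℝ ((↑) : s → Fin n → ℝ) := by
  have h := Φ.affineIndependent_vertex.range
  refine h.mono ?_
  intro v hv
  have := hs hv
  simpa [vertices] using this

/-- A vertex that carries positive weight is a level set of the point. -/
lemma weight_pos {s : Finset (Fin n → ℝ)} (hs : s ⊆ Φ.vertices) {w : (Fin n → ℝ) → ℝ}
    (h0 : ∀ v ∈ s, 0 ≤ w v) (h1 : ∑ v ∈ s, w v = 1) (v : Fin n → ℝ) :
    (v ∈ s ∧ 0 < w v) ↔ ∃ θ : ℝ, 0 < θ ∧ θ ≤ 1 ∧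
      v = fun i => if θ ≤ (∑ v ∈ s, w v • v) i then 1 else 0 := by
  classical
  set W : Fin (Φ.length + 1) → ℝ := fun k => if Φ.vertex k ∈ s then w (Φ.vertex k) else 0 with hW
  have tr : ∀ {M : Type} [AddCommMonoid M] (f : (Fin n → ℝ) → M),
      ∑ v ∈ s, f v = ∑ k, if Φ.vertex k ∈ s then f (Φ.vertex k) else 0 := by
    intro M _ f
    have : ∑ v ∈ s, f v = ∑ v ∈ Φ.vertices, if v ∈ s then f v else 0 := by
      rw [Finset.sum_ite_mem, Finset.inter_eq_right.2 hs]
    rw [this, vertices, Finset.sum_image (fun _ _ _ _ h => Φ.vertex_injective h)]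
  have W0 : ∀ k, 0 ≤ W k := by
    intro k
    simp only [hW]
    split_ifs with h
    · exact h0 _ h
    · exact le_rfl
  have W1 : ∑ k, W k = 1 := by rw [← h1, tr]
  have Wx : ∑ v ∈ s, w v • v = ∑ k, W k • Φ.vertex k := by
    rw [tr]
    refine Finset.sum_congr rfl fun k _ => ?_
    simp only [hW]
    split_ifs <;> simp
  rw [Wx]
  simp only [Φ.sum_vertex_apply]
  set F : Fin (Φ.length + 1) → ℝ := fun j => ∑ k ∈ Finset.Iic j, W k with hF
  have Fmono : Monotone F := fun a b hab =>
    Finset.sum_le_sum_of_subset_of_nonneg (Finset.Iic_subset_Iic.2 hab) (fun k _ _ => W0 k)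
  have Flt : ∀ a b, a < b → F a + W b ≤ F b := by
    intro a b hab
    simp only [hF]
    rw [← Finset.Iio_insert b, Finset.sum_insert (by simp), add_comm]
    refine add_le_add le_rfl (Finset.sum_le_sum_of_subset_of_nonneg ?_ (fun k _ _ => W0 k))
    intro k hk
    simp only [Finset.mem_Iic, Finset.mem_Iio] at hk ⊢
    exact lt_of_le_of_lt hk hab
  have Flast : F (Fin.last _) = 1 := by
    rw [← W1]
    simp only [hF]
    congr 1
    ext k
    simp [Fin.le_last]
  have FW : ∀ k, W k ≤ F k := fun k =>
    Finset.single_le_sum (f := W) (fun k _ => W0 k) (Finset.mem_Iic.2 le_rfl)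
  constructor
  · rintro ⟨hv, hpos⟩
    have : ∃ k, Φ.vertex k = v := by simpa [vertices] using hs hv
    obtain ⟨k, rfl⟩ := this
    have Wk : 0 < W k := by simpa [hW, hv] using hpos
    refine ⟨F k, lt_of_lt_of_le Wk (FW k), Flast ▸ Fmono (Fin.le_last k), ?_⟩
    funext i
    have : k ≤ (Φ.index i).castSucc ↔ F k ≤ F (Φ.index i).castSucc := by
      refine ⟨fun h => Fmono h, fun h => ?_⟩
      by_contra hc
      have := Flt _ _ (not_le.1 hc)
      linarith
    simp only [vertex, this, hF]
  · rintro ⟨θ, hθ0, hθ1, rfl⟩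
    have hne : (Finset.univ.filter fun k => θ ≤ F k).Nonempty :=
      ⟨Fin.last _, by simp [Flast, hθ1]⟩
    obtain ⟨k, hk⟩ : ∃ k, ∀ j, k ≤ j ↔ θ ≤ F j := by
      refine ⟨Finset.min' _ hne, fun j => ⟨fun h => ?_, fun h => ?_⟩⟩
      · have := Finset.min'_mem _ hne
        simp only [Finset.mem_filter, Finset.mem_univ, true_and] at this
        exact this.trans (Fmono h)
      · exact Finset.min'_le _ _ (by simp [h])
    have hv : (fun i => if θ ≤ F (Φ.index i).castSucc then (1 : ℝ) else 0) = Φ.vertex k := by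
      funext i
      simp only [vertex, hk]
    have Wk : 0 < W k := by
      by_contra hc
      have hz : W k = 0 := le_antisymm (not_lt.1 hc) (W0 k)
      have hkk := (hk k).1 le_rfl
      have : F k = ∑ j ∈ Finset.Iio k, W j := by
        simp only [hF]
        rw [← Finset.Iio_insert k, Finset.sum_insert (by simp), hz, zero_add]
      rcases (Finset.Iio k).eq_empty_or_nonempty with he | he
      · rw [this, he, Finset.sum_empty] at hkk
        linarith
      · set m := (Finset.Iio k).max' he with hm
        have hmk : m < k := Finset.mem_Iio.1 (Finset.max'_mem _ he)
        have : F m = F k := by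
          rw [this]
          simp only [hF]
          congr 1
          ext j
          simp only [Finset.mem_Iic, Finset.mem_Iio]
          exact ⟨fun h => lt_of_le_of_lt h hmk,
            fun h => Finset.le_max' _ _ (Finset.mem_Iio.2 h)⟩
        exact absurd ((hk m).2 (this ▸ hkk)) (not_le.2 hmk)
    rw [hv]
    by_cases h : Φ.vertex k ∈ s
    · exact ⟨h, by simpa [hW, h] using Wk⟩
    · simp [hW, h] at Wk

lemma inter_subset_convexHull (Ψ : OrderedSetPartition n) {s t : Finset (Fin n → ℝ)}
    (hs : s ⊆ Φ.vertices) (ht : t ⊆ Ψ.vertices) :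
    convexHull ℝ (s : Set (Fin n → ℝ)) ∩ convexHull ℝ (t : Set (Fin n → ℝ)) ⊆
      convexHull ℝ ((s : Set (Fin n → ℝ)) ∩ (t : Set (Fin n → ℝ))) := by
  classical
  rintro x ⟨hxs, hxt⟩
  obtain ⟨w, w0, w1, wx⟩ := Finset.mem_convexHull'.1 hxs
  obtain ⟨w', w0', w1', wx'⟩ := Finset.mem_convexHull'.1 hxt
  have hz : ∀ v ∈ s, v ∉ s ∩ t → w v = 0 := by
    intro v hv hvt
    by_contra hne
    have hp := (Φ.weight_pos hs w0 w1 v).1 ⟨hv, lt_of_le_of_ne (w0 v hv) (Ne.symm hne)⟩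
    rw [wx, ← wx'] at hp
    exact hvt (Finset.mem_inter.2 ⟨hv, ((Ψ.weight_pos ht w0' w1' v).2 hp).1⟩)
  rw [← Finset.coe_inter, Finset.mem_convexHull']
  refine ⟨w, fun v hv => w0 v (Finset.mem_inter.1 hv).1, ?_, ?_⟩
  · rw [← w1]
    exact Finset.sum_subset Finset.inter_subset_left hz
  · rw [← wx]
    exact Finset.sum_subset Finset.inter_subset_left fun v hv hvt => by rw [hz v hv hvt, zero_smul]

/-- The face `σ_Φ` is the set of all points of the open cube whose relative order is `Φ`. -/
lemma openSimplex_vertices :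
    openSimplex Φ.vertices = {x | (∀ i, 0 < x i ∧ x i < 1) ∧ Φ.IsOrderOf x} := by
  classical
  have hsum : ∀ {M : Type} [AddCommMonoid M] (f : (Fin n → ℝ) → M),
      ∑ v ∈ Φ.vertices, f v = ∑ k, f (Φ.vertex k) := by
    intro M _ f
    rw [vertices, Finset.sum_image (fun _ _ _ _ h => Φ.vertex_injective h)]
  ext x
  constructor
  · rintro ⟨w, -, w0, w1, rfl⟩
    rw [hsum] at w1
    simp only [hsum]
    have hp : ∀ k, 0 < w (Φ.vertex k) := fun k => w0 _ (by simp [vertices])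
    have hx := Φ.sum_vertex_apply (fun k => w (Φ.vertex k))
    refine ⟨fun i => ⟨?_, ?_⟩, fun i j hij => ?_, fun i j hij => ?_⟩
    · rw [hx]
      exact Finset.sum_pos (fun k _ => hp k) ⟨0, by simp⟩
    · rw [hx, ← w1]
      refine Finset.sum_lt_sum_of_subset (i := Fin.last _) (Finset.subset_univ _)
        (Finset.mem_univ _) ?_ (hp _) (fun k _ _ => (hp k).le)
      simp
    · rw [hx, hx, hij]
    · rw [hx, hx]
      refine Finset.sum_lt_sum_of_subset (i := (Φ.index j).castSucc) ?_ ?_ ?_ (hp _)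
        (fun k _ _ => (hp k).le)
      · exact Finset.Iic_subset_Iic.2 (Fin.castSucc_le_castSucc_iff.2 hij.le)
      · simp
      · simpa using hij
  · rintro ⟨hcube, heq, hlt⟩
    choose r hr using Φ.surj
    -- the extended increasing sequence `0 < c 0 < ⋯ < c (length - 1) < 1`
    set c : ℕ → ℝ := fun m => if h : m < Φ.length then x (r ⟨m, h⟩) else 1 with hc
    have hc0 : ∀ m, 0 < c m := by
      intro m
      simp only [hc]
      split_ifs
      · exact (hcube _).1
      · exact one_pos
    have hcs : ∀ m, m < Φ.length → c m < c (m + 1) := by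
      intro m hm
      simp only [hc, dif_pos hm]
      split_ifs with h
      · exact hlt _ _ (by rw [hr, hr]; exact Nat.lt_succ_self m)
      · exact (hcube _).2
    set W : ℕ → ℝ := fun m => if m = 0 then c 0 else c m - c (m - 1) with hW
    have hWs : ∀ m, ∑ k ∈ Finset.range (m + 1), W k = c m := by
      intro m
      induction m with
      | zero => simp [hW]
      | succ m ih => rw [Finset.sum_range_succ, ih]; simp [hW]
    have hWp : ∀ m, m ≤ Φ.length → 0 < W m := by
      intro m hm
      rcases m with _ | m
      · simpa [hW] using hc0 0
      · have := hcs m (by omega)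
        simp only [hW, Nat.succ_ne_zero, if_false, Nat.add_sub_cancel]
        linarith
    have hinv : ∀ k, Function.invFun Φ.vertex (Φ.vertex k) = k :=
      Function.leftInverse_invFun Φ.vertex_injective
    have hpos : ∀ v, 0 < W (Function.invFun Φ.vertex v).1 := fun v =>
      hWp _ (Nat.lt_succ_iff.1 (Function.invFun Φ.vertex v).2)
    refine ⟨fun v => W (Function.invFun Φ.vertex v).1, fun v _ => (hpos v).le,
      fun v _ => hpos v, ?_, ?_⟩
    · rw [hsum]
      simp only [hinv]
      rw [Fin.sum_univ_eq_sum_range W, hWs]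
      simp [hc]
    · rw [hsum]
      simp only [hinv]
      funext i
      rw [Φ.sum_vertex_apply (fun k => W k.1)]
      have h1 : ∑ k ∈ Finset.Iic ((Φ.index i).castSucc : Fin (Φ.length + 1)), W k.1
          = ∑ k ∈ Finset.range ((Φ.index i).1 + 1), W k := by
        refine Finset.sum_bij (fun (k : Fin (Φ.length + 1)) _ => k.1) ?_ ?_ ?_ ?_
        · intro k hk
          have : k ≤ (Φ.index i).castSucc := Finset.mem_Iic.1 hk
          have : k.1 ≤ (Φ.index i).1 := this
          simp only [Finset.mem_range]
          omega
        · intro a _ b _ h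
          exact Fin.ext h
        · intro b hb
          simp only [Finset.mem_range] at hb
          have := (Φ.index i).2
          exact ⟨⟨b, by omega⟩, Finset.mem_Iic.2 (by
            change b ≤ (Φ.index i).1
            omega), rfl⟩
        · intro _ _
          rfl
      rw [h1, hWs]
      simp only [hc, dif_pos (Φ.index i).2]
      exact heq _ _ (hr _)

end OrderedSetPartition

/-- The allowed configuration `Allow(S)`, as a partial simplicial complex: the faces `σ_Φ` of the
braid triangulation of the open cube `(0,1)ⁿ` for which `S(Φ)` holds, inside the simplicial
complex formed by the closures of these faces. -/
def allow {n : ℕ} (S : Problem n) : PartialComplex (Fin n → ℝ) where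
  closed :=
    { faces := {s | s.Nonempty ∧ ∃ Φ : OrderedSetPartition n, S.SolvedBy Φ ∧ s ⊆ Φ.vertices}
      isRelLowerSet_faces := by
        rintro s ⟨hs, Φ, hΦ, hsub⟩
        exact ⟨hs, fun t hts ht => ⟨ht, Φ, hΦ, hts.trans hsub⟩⟩
      indep := by
        rintro s ⟨-, Φ, -, hsub⟩
        exact Φ.affineIndependent_vertices hsub
      inter_subset_convexHull := by
        rintro s t ⟨-, Φ, -, hs⟩ ⟨-, Ψ, -, ht⟩
        exact Φ.inter_subset_convexHull Ψ hs ht }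
  faces := {s | ∃ Φ : OrderedSetPartition n, S.SolvedBy Φ ∧ s = Φ.vertices}
  faces_subset := by
    rintro s ⟨Φ, hΦ, rfl⟩
    exact ⟨Finset.card_pos.1 (by rw [Φ.card_vertices]; omega), Φ, hΦ, Finset.Subset.refl _⟩
  facets_subset := by
    rintro s ⟨⟨-, Φ, hΦ, hsub⟩, hmax⟩
    refine ⟨Φ, hΦ, hmax ⟨?_, Φ, hΦ, Finset.Subset.refl _⟩ hsub⟩
    exact Finset.card_pos.1 (by rw [Φ.card_vertices]; omega)

end Scheduling

end

open Scheduling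

/-!
The solution set `P` of a solvable conjunction with at most one weak inequality is partitioned by
pushing its points in a fixed generic direction. Let `ρ` be a permutation of the items, regarded
as a point of `ℝⁿ`. For small `ε > 0` the point `x + ε ρ` lies in a maximal open cell of the braid
arrangement, the cell of a permutation `τ`; equivalently, `τ` sorts the items by `x` and breaks
ties by `ρ` (`Refines τ ρ x`). The points of the open cube that are sent to the cell of `τ` form a
half-open simplex: of the facets of the closed simplex of `τ`, those in the boundary of the cube
and those on which two items are tied that `ρ` orders the other way are removed
(`halfOpenSimplex_descentVertices`).

It remains to choose `ρ` such that `x ∈ P` if and only if the whole cell of `τ` lies in `P`. This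
holds as soon as `ρ` violates every strict inequality of `P` and satisfies the weak one strictly:
a tie in a strict inequality then leads out of `P`, a tie in the weak one leads into `P`
(`Refines.mem_solutionSet_iff`). If some solution `w` of the strict inequalities violates the weak
one, `ρ` can be taken to order the items as `-w` does; otherwise the weak inequality is redundant
and can be dropped, and any `w ∈ P` will do (`exists_list_and_perm`).

In particular a nonempty `P` contains a cell, so it has dimension `n`, and every face in it lies
in a maximal face in it. For a disjoint union of such sets, the partitions of the parts are
united (`partitionable_allow`).
-/

open Scheduling

namespace Scheduling

variable {n : ℕ}

/-! ### Truth of formulas -/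

lemma Problem.holds_congr {α β : Type*} [LE α] [LE β] {x : Fin n → α} {y : Fin n → β}
    (h : ∀ i j, x i ≤ x j ↔ y i ≤ y j) (S : Problem n) : S.Holds x ↔ S.Holds y := by
  induction S with
  | atom i j => exact h i j
  | false => exact Iff.rfl
  | not S ih => exact not_congr ih
  | and S T ihS ihT => exact and_congr ihS ihT
  | or S T ihS ihT => exact or_congr ihS ihT

lemma Ineq.holds_toProblem (I : Ineq n) (x : Fin n → ℝ) :
    I.toProblem.Holds x ↔ if I.weak then x I.lhs ≤ x I.rhs else x I.lhs < x I.rhs := by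
  unfold Ineq.toProblem
  split_ifs
  · exact Iff.rfl
  · exact not_le

lemma mem_solutionSet_conj {L : List (Ineq n)} {x : Fin n → ℝ} :
    x ∈ (conj L).solutionSet ↔ ∀ I ∈ L, if I.weak then x I.lhs ≤ x I.rhs else x I.lhs < x I.rhs := by
  induction L with
  | nil => simp [conj, Problem.solutionSet, Problem.Holds]
  | cons I L ih =>
    rw [List.forall_mem_cons, ← ih, ← I.holds_toProblem]
    exact Iff.rfl

lemma mem_solutionSet_disj {C : List (Problem n)} {x : Fin n → ℝ} :
    x ∈ (Problem.disj C).solutionSet ↔ ∃ S ∈ C, x ∈ S.solutionSet := by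
  induction C with
  | nil => simp [Problem.disj, Problem.solutionSet, Problem.Holds]
  | cons S C ih =>
    rw [List.exists_mem_cons_iff, ← ih]
    exact Iff.rfl

/-! ### Ordered set partitions and points -/

namespace OrderedSetPartition

lemma IsOrderOf.le_iff {Φ : OrderedSetPartition n} {α : Type*} [LinearOrder α] {a : Fin n → α}
    (h : Φ.IsOrderOf a) (i j : Fin n) : a i ≤ a j ↔ Φ.index i ≤ Φ.index j := by
  rcases lt_trichotomy (Φ.index i) (Φ.index j) with hij | hij | hij
  · exact iff_of_true (h.2 _ _ hij).le hij.le
  · exact iff_of_true (h.1 _ _ hij).le hij.le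
  · exact iff_of_false (h.2 _ _ hij).not_ge hij.not_ge

lemma exists_isOrderOf (x : Fin n → ℝ) : ∃ Φ : OrderedSetPartition n, Φ.IsOrderOf x := by
  classical
  let e := (Finset.univ.image x).orderIsoOfFin rfl
  have hx : ∀ i, x i ∈ Finset.univ.image x := fun i => Finset.mem_image_of_mem _ (Finset.mem_univ i)
  refine ⟨⟨_, fun i => e.symm ⟨x i, hx i⟩, fun k => ?_⟩, fun i j hij => ?_, fun i j hij => ?_⟩
  · obtain ⟨i, -, hi⟩ := Finset.mem_image.1 (e k).2
    refine ⟨i, ?_⟩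
    rw [OrderIso.symm_apply_eq]
    exact Subtype.ext hi
  · exact congrArg Subtype.val (e.symm.injective hij)
  · exact e.symm.lt_iff_lt.1 hij

/-- A face solves `S` if and only if one real point with that relative order does: the truth of
`S` depends only on the relative order. -/
lemma IsOrderOf.solvedBy_iff {Φ : OrderedSetPartition n} {x : Fin n → ℝ} (h : Φ.IsOrderOf x)
    (S : Problem n) : S.SolvedBy Φ ↔ x ∈ S.solutionSet := by
  constructor
  · intro hS
    have ha : Φ.IsOrderOf fun i => (Φ.index i : ℕ) + 1 :=
      ⟨fun i j hij => by simp [hij], fun i j hij => Nat.succ_lt_succ hij⟩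
    exact (Problem.holds_congr (fun i j => (ha.le_iff i j).trans (h.le_iff i j).symm) S).1
      (hS _ (fun i => Nat.succ_pos _) ha)
  · intro hS a _ ha
    exact (Problem.holds_congr (fun i j => (ha.le_iff i j).trans (h.le_iff i j).symm) S).2 hS

lemma nonempty_openSimplex_vertices (Φ : OrderedSetPartition n) :
    (openSimplex Φ.vertices).Nonempty := by
  have hl : (0 : ℝ) < Φ.length + 1 := by positivity
  rw [Φ.openSimplex_vertices]
  refine ⟨fun i => ((Φ.index i : ℕ) + 1 : ℝ) / (Φ.length + 1), fun i => ⟨by positivity, ?_⟩,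
    fun i j hij => by simp [hij], fun i j hij => ?_⟩
  · rw [div_lt_one hl]
    have : ((Φ.index i : ℕ) : ℝ) < Φ.length := by exact_mod_cast (Φ.index i).2
    linarith
  · have : ((Φ.index i : ℕ) : ℝ) < (Φ.index j : ℕ) := by exact_mod_cast hij
    simp only
    gcongr

/-- If some point of the relatively open simplex of `Φ` lies in the closed simplex of `Ψ`, then
`σ_Φ` is a face of `σ_Ψ`, since the vertices of the carrier of a point are its level sets. -/
lemma vertices_subset_of_mem {Φ Ψ : OrderedSetPartition n} {x : Fin n → ℝ}
    {l : Finset (Fin n → ℝ)} (hΦ : x ∈ openSimplex Φ.vertices)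
    (hΨ : x ∈ halfOpenSimplex l Ψ.vertices) : Φ.vertices ⊆ Ψ.vertices := by
  obtain ⟨w, w0, wp, w1, wx⟩ := hΦ
  obtain ⟨w', w0', -, w1', wx'⟩ := hΨ
  intro v hv
  have h := (Φ.weight_pos (Finset.Subset.refl _) w0 w1 v).1 ⟨hv, wp v hv⟩
  rw [wx, ← wx'] at h
  exact ((Ψ.weight_pos (Finset.Subset.refl _) w0' w1' v).2 h).1

/-- The ordered set partition into singletons in which `i` has position `τ i`. -/
def ofPerm (τ : Equiv.Perm (Fin n)) : OrderedSetPartition n := ⟨n, τ, τ.surjective⟩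

lemma isOrderOf_ofPerm (τ : Equiv.Perm (Fin n)) :
    (ofPerm τ).IsOrderOf fun i => ((τ i : ℕ) : ℝ) :=
  ⟨fun _ _ hij => congrArg (fun k : Fin n => ((k : ℕ) : ℝ)) hij, fun _ _ hij => Nat.cast_lt.2 hij⟩

end OrderedSetPartition

open OrderedSetPartition

/-! ### Breaking ties by a permutation -/

/-- `τ` lists the items by increasing value of `x`, ties being broken by `ρ`; equivalently,
`x + ε ρ` has relative order `τ` for all small `ε > 0`. -/
def Refines (τ ρ : Equiv.Perm (Fin n)) (x : Fin n → ℝ) : Prop :=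
  ∀ i j, τ i < τ j ↔ x i < x j ∨ x i = x j ∧ ρ i < ρ j

lemma exists_refines (ρ : Equiv.Perm (Fin n)) (x : Fin n → ℝ) : ∃ τ, Refines τ ρ x := by
  let f : Fin n → ℝ ×ₗ Fin n := fun i => toLex (x i, ρ i)
  have hf : Function.Injective f := fun i j h => by
    have := congrArg (fun p => (ofLex p).2) h
    exact ρ.injective this
  have hs : StrictMono (f ∘ Tuple.sort f) :=
    (Tuple.monotone_sort f).strictMono_of_injective (hf.comp (Tuple.sort f).injective)
  refine ⟨(Tuple.sort f).symm, fun i j => ?_⟩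
  rw [← hs.lt_iff_lt]
  simp [f, Prod.Lex.toLex_lt_toLex]

lemma Refines.unique {τ τ' ρ : Equiv.Perm (Fin n)} {x : Fin n → ℝ} (h : Refines τ ρ x)
    (h' : Refines τ' ρ x) : τ = τ' := by
  have hm : StrictMono (τ.symm.trans τ') := fun a b hab => by
    have := (h' (τ.symm a) (τ.symm b)).2 ((h _ _).1 (by simpa using hab))
    simpa using this
  have hid : ∀ a, τ' (τ.symm a) = a := fun a =>
    congrFun (congrArg DFunLike.coe
      (Subsingleton.elim (hm.orderIsoOfSurjective _ (τ.symm.trans τ').surjective)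
        (OrderIso.refl _))) a
  ext i
  have := hid (τ i)
  simp only [Equiv.symm_apply_apply] at this
  rw [this]

lemma Refines.of_forall_lt {τ ρ : Equiv.Perm (Fin n)} {x : Fin n → ℝ}
    (h : ∀ i j, τ i < τ j → x i < x j ∨ x i = x j ∧ ρ i < ρ j) : Refines τ ρ x := by
  intro i j
  refine ⟨h i j, fun hx => ?_⟩
  rcases lt_trichotomy (τ i) (τ j) with hij | hij | hij
  · exact hij
  · rw [τ.injective hij] at hx
    simp at hx
  · rcases h j i hij with h1 | ⟨h1, h2⟩ <;> rcases hx with h3 | ⟨h3, h4⟩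
    · exact absurd h1 h3.asymm
    · exact absurd h3 h1.ne'
    · exact absurd h1 h3.ne'
    · exact absurd h2 h4.asymm

/-- Indices of the vertices of the simplex of `τ` opposite to the facets removed when ties are
broken by `ρ`. Vertices `0` and `n` are always among them, the condition being void: the facets
opposite to them lie in the boundary of the cube. Vertex `k` with `0 < k < n` is opposite to the
facet on which the items at positions `k - 1` and `k` are tied. -/
def descents (τ ρ : Equiv.Perm (Fin n)) : Finset (Fin (n + 1)) :=
  Finset.univ.filter fun k => ∀ i j, (τ i : ℕ) + 1 = k → (τ j : ℕ) = k → ρ j < ρ i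

open Classical in
/-- The vertices of the simplex of `τ` with index in `descents τ ρ`. -/
noncomputable def descentVertices (τ ρ : Equiv.Perm (Fin n)) : Finset (Fin n → ℝ) :=
  (descents τ ρ).image (ofPerm τ).vertex

lemma descentVertices_subset (τ ρ : Equiv.Perm (Fin n)) :
    descentVertices τ ρ ⊆ (ofPerm τ).vertices := by
  classical
  exact Finset.image_subset_image (Finset.subset_univ _)

/-- Barycentric coordinates with respect to the simplex of `τ`. -/
lemma mem_halfOpenSimplex_ofPerm {τ ρ : Equiv.Perm (Fin n)} {x : Fin n → ℝ} :
    x ∈ halfOpenSimplex (descentVertices τ ρ) (ofPerm τ).vertices ↔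
      ∃ W : Fin (n + 1) → ℝ, (∀ k, 0 ≤ W k) ∧ (∀ k ∈ descents τ ρ, 0 < W k) ∧ ∑ k, W k = 1 ∧
        ∀ i, ∑ k ∈ Finset.Iic (τ i).castSucc, W k = x i := by
  classical
  let V : Fin (n + 1) → Fin n → ℝ := (ofPerm τ).vertex
  have hV : Function.Injective V := (ofPerm τ).vertex_injective
  have hVx : ∀ (W : Fin (n + 1) → ℝ) i,
      (∑ k, W k • V k) i = ∑ k ∈ Finset.Iic (τ i).castSucc, W k := (ofPerm τ).sum_vertex_apply
  have hu : (ofPerm τ).vertices = Finset.univ.image V := rfl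
  have hl : descentVertices τ ρ = (descents τ ρ).image V := rfl
  have hsum : ∀ {M : Type} [AddCommMonoid M] (f : (Fin n → ℝ) → M),
      ∑ v ∈ Finset.univ.image V, f v = ∑ k, f (V k) := fun f =>
    Finset.sum_image fun _ _ _ _ h => hV h
  rw [hu, hl]
  constructor
  · rintro ⟨w, w0, wp, w1, rfl⟩
    refine ⟨fun k => w (V k), fun k => w0 _ (Finset.mem_image_of_mem _ (Finset.mem_univ _)),
      fun k hk => wp _ (Finset.mem_image_of_mem _ hk), (hsum w).symm.trans w1, fun i => ?_⟩
    rw [hsum, hVx (fun k => w (V k))]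
  · rintro ⟨W, W0, Wp, W1, Wx⟩
    have hinv : ∀ k, Function.invFun V (V k) = k := Function.leftInverse_invFun hV
    refine ⟨fun v => W (Function.invFun V v), fun v _ => W0 _, ?_, ?_, ?_⟩
    · intro v hv
      obtain ⟨k, hk, rfl⟩ := Finset.mem_image.1 hv
      simp only [hinv]
      exact Wp k hk
    · rw [hsum]
      simp only [hinv]
      exact W1
    · rw [hsum]
      simp only [hinv]
      funext i
      rw [hVx, Wx]

lemma mem_cube_and_refines_of_weights {τ ρ : Equiv.Perm (Fin n)} {x : Fin n → ℝ}
    {W : Fin (n + 1) → ℝ} (W0 : ∀ k, 0 ≤ W k) (Wp : ∀ k ∈ descents τ ρ, 0 < W k)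
    (W1 : ∑ k, W k = 1) (Wx : ∀ i, ∑ k ∈ Finset.Iic (τ i).castSucc, W k = x i) :
    (∀ i, 0 < x i ∧ x i < 1) ∧ Refines τ ρ x := by
  have h0 : (0 : Fin (n + 1)) ∈ descents τ ρ := by simp [descents]
  have hn : Fin.last n ∈ descents τ ρ := by
    simp only [descents, Finset.mem_filter, Finset.mem_univ, true_and, Fin.val_last]
    intro i j _ hj
    exact absurd (τ j).2 (by omega)
  refine ⟨fun i => ⟨?_, ?_⟩, Refines.of_forall_lt ?_⟩
  · rw [← Wx]
    exact Finset.sum_pos' (fun k _ => W0 k) ⟨0, by simp, Wp _ h0⟩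
  · rw [← Wx, ← W1]
    exact Finset.sum_lt_sum_of_subset (i := Fin.last _) (Finset.subset_univ _)
      (Finset.mem_univ _) (by simp) (Wp _ hn) (fun k _ _ => W0 k)
  · -- neighbouring positions first, then induction on the distance of the positions
    have hstep : ∀ i j, (τ j : ℕ) = τ i + 1 → x i < x j ∨ x i = x j ∧ ρ i < ρ j := by
      intro i j hij
      have hx : x j = W (τ j).castSucc + x i := by
        rw [← Wx, ← Wx, ← Finset.Iio_insert, Finset.sum_insert (by simp)]
        congr 2
        ext k
        simp only [Finset.mem_Iio, Finset.mem_Iic, Fin.lt_def, Fin.le_def, Fin.val_castSucc]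
        omega
      rcases (W0 (τ j).castSucc).eq_or_lt with hW | hW
      · right
        refine ⟨by rw [hx, ← hW, zero_add], ?_⟩
        by_contra hρ
        refine (Wp (τ j).castSucc ?_).ne hW
        simp only [descents, Finset.mem_filter, Finset.mem_univ, true_and, Fin.val_castSucc]
        intro i' j' hi' hj'
        obtain rfl : j' = j := τ.injective (Fin.ext hj')
        obtain rfl : i' = i := τ.injective (Fin.ext (by omega))
        refine lt_of_le_of_ne (not_lt.1 hρ) fun he => ?_
        rw [ρ.injective he] at hij
        omega
      · left
        linarith
    have hind : ∀ m : ℕ, ∀ i j, (τ j : ℕ) = τ i + 1 + m → x i < x j ∨ x i = x j ∧ ρ i < ρ j := by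
      intro m
      induction m with
      | zero => exact hstep
      | succ m ih =>
        intro i j hij
        have hlt : (τ i : ℕ) + 1 + m < n := by have := (τ j).2; omega
        rcases ih i (τ.symm ⟨_, hlt⟩) (by simp) with h1 | ⟨h1, h1'⟩ <;>
          rcases hstep (τ.symm ⟨_, hlt⟩) j (by simp; omega) with h2 | ⟨h2, h2'⟩
        · exact .inl (h1.trans h2)
        · exact .inl (h1.trans_eq h2)
        · exact .inl (h1.trans_lt h2)
        · exact .inr ⟨h1.trans h2, h1'.trans h2'⟩
    intro i j hij
    exact hind ((τ j : ℕ) - (τ i + 1)) i j (by have : (τ i : ℕ) < τ j := hij; omega)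

lemma exists_weights_of_refines {τ ρ : Equiv.Perm (Fin n)} {x : Fin n → ℝ}
    (hx : ∀ i, 0 < x i ∧ x i < 1) (hr : Refines τ ρ x) :
    ∃ W : Fin (n + 1) → ℝ, (∀ k, 0 ≤ W k) ∧ (∀ k ∈ descents τ ρ, 0 < W k) ∧ ∑ k, W k = 1 ∧
      ∀ i, ∑ k ∈ Finset.Iic (τ i).castSucc, W k = x i := by
  -- the sorted coordinates of `x`, shifted by one and extended by `0` on the left, `1` on the right
  let c : ℕ → ℝ := fun m =>
    if m = 0 then 0 else if h : m - 1 < n then x (τ.symm ⟨m - 1, h⟩) else 1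
  have c0 : c 0 = 0 := rfl
  have cs : ∀ i, c (τ i + 1) = x i := fun i => by simp [c]
  have cn : c (n + 1) = 1 := by simp [c]
  have hτ : ∀ m < n, ∃ i, (τ i : ℕ) = m := fun m hm => ⟨τ.symm ⟨m, hm⟩, by simp⟩
  -- the first and the last step are positive, the others are nonnegative
  have hstep : ∀ m ≤ n, c m < c (m + 1) ∨ ∃ i j, (τ i : ℕ) + 1 = m ∧ (τ j : ℕ) = m ∧
      c m = c (m + 1) ∧ ρ i < ρ j := by
    intro m hm
    rcases m with _ | m
    · left
      rw [c0]
      rcases n.eq_zero_or_pos with rfl | hn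
      · rw [cn]; exact one_pos
      · obtain ⟨i, hi⟩ := hτ 0 hn
        rw [← hi, cs]; exact (hx i).1
    · obtain ⟨i, hi⟩ := hτ m hm
      rcases hm.eq_or_lt with he | hlt
      · left
        rw [he, cn, ← he, ← hi, cs]; exact (hx i).2
      · obtain ⟨j, hj⟩ := hτ (m + 1) hlt
        have hij : τ i < τ j := by rw [Fin.lt_def]; omega
        have h1 : c (m + 1) = x i := by rw [← hi, cs]
        have h2 : c (m + 1 + 1) = x j := by rw [← hj, cs]
        rcases (hr i j).1 hij with h | ⟨h, h'⟩
        · exact .inl (by rw [h1, h2]; exact h)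
        · exact .inr ⟨i, j, by omega, hj, by rw [h1, h2, h], h'⟩
  refine ⟨fun k => c (k + 1) - c k, fun k => ?_, fun k hk => ?_, ?_, fun i => ?_⟩
  · rcases hstep k (Nat.lt_succ_iff.1 k.2) with h | ⟨i, j, -, -, h, -⟩ <;> linarith
  · rcases hstep k (Nat.lt_succ_iff.1 k.2) with h | ⟨i, j, hi, hj, -, h⟩
    · exact sub_pos.2 h
    · exact absurd ((Finset.mem_filter.1 hk).2 i j hi hj) h.asymm
  · rw [Fin.sum_univ_eq_sum_range (fun m => c (m + 1) - c m) (n + 1), Finset.sum_range_sub, cn, c0,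
      sub_zero]
  · have himg : (Finset.Iic (τ i).castSucc).map Fin.valEmbedding = Finset.range (τ i + 1) := by
      rw [Fin.map_valEmbedding_Iic]
      ext m
      simp
    have := Finset.sum_map (Finset.Iic (τ i).castSucc) Fin.valEmbedding (fun m => c (m + 1) - c m)
    rw [himg, Finset.sum_range_sub, c0, sub_zero, cs] at this
    exact this.symm

/-- For fixed `ρ`, these half-open simplices partition the open cube. -/
lemma halfOpenSimplex_descentVertices (τ ρ : Equiv.Perm (Fin n)) :
    halfOpenSimplex (descentVertices τ ρ) (ofPerm τ).vertices =
      {x | (∀ i, 0 < x i ∧ x i < 1) ∧ Refines τ ρ x} := by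
  ext x
  rw [mem_halfOpenSimplex_ofPerm]
  constructor
  · rintro ⟨W, W0, Wp, W1, Wx⟩
    exact mem_cube_and_refines_of_weights W0 Wp W1 Wx
  · rintro ⟨hx, hr⟩
    exact exists_weights_of_refines hx hr

/-! ### Conjunctions with at most one weak inequality -/

/-- If `ρ` violates every strict inequality and satisfies every weak one strictly, then
breaking ties by `ρ` neither leaves nor enters the solution set. -/
lemma Refines.mem_solutionSet_iff {L : List (Ineq n)} {τ ρ : Equiv.Perm (Fin n)} {x : Fin n → ℝ}
    (hr : Refines τ ρ x)
    (hρ : ∀ I ∈ L, if I.weak then ρ I.lhs < ρ I.rhs else ρ I.rhs < ρ I.lhs) :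
    x ∈ (conj L).solutionSet ↔ ∀ I ∈ L, τ I.lhs < τ I.rhs := by
  rw [mem_solutionSet_conj]
  refine forall₂_congr fun I hI => ?_
  have h := hρ I hI
  rw [hr]
  split_ifs at h ⊢
  · rw [le_iff_lt_or_eq]
    simp [h]
  · simp [h.asymm]

/-- A solvable conjunction with at most one weak inequality admits a list of the same solutions,
together with a permutation violating its strict inequalities and satisfying the weak one
strictly. -/
lemma exists_list_and_perm {L : List (Ineq n)} (hL : (L.filter fun I => I.weak).length ≤ 1)
    (hne : (conj L).solutionSet.Nonempty) :
    ∃ (L' : List (Ineq n)) (ρ : Equiv.Perm (Fin n)),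
      (conj L').solutionSet = (conj L).solutionSet ∧
        ∀ I ∈ L', if I.weak then ρ I.lhs < ρ I.rhs else ρ I.rhs < ρ I.lhs := by
  set L' := L.filter fun I => !I.weak with hL'
  have mem' : ∀ {I}, I ∈ L' ↔ I ∈ L ∧ I.weak = Bool.false := by simp [hL']
  have key : ∀ w : Fin n → ℝ, ∃ ρ : Equiv.Perm (Fin n), ∀ i j, w i < w j → ρ j < ρ i := by
    intro w
    obtain ⟨ρ, hρ⟩ := exists_refines 1 (-w)
    exact ⟨ρ, fun i j h => (hρ j i).2 (.inl (neg_lt_neg h))⟩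
  -- either a solution of the strict inequalities violates the weak ones, or these are redundant
  by_cases hw : ∃ w ∈ (conj L').solutionSet, ∀ I ∈ L, I.weak → w I.rhs < w I.lhs
  · obtain ⟨w, hw, hw'⟩ := hw
    obtain ⟨ρ, hρ⟩ := key w
    refine ⟨L, ρ, rfl, fun I hI => ?_⟩
    split_ifs with h
    · exact hρ _ _ (hw' I hI h)
    · have hb : I.weak = Bool.false := by simpa using h
      have := mem_solutionSet_conj.1 hw I (mem'.2 ⟨hI, hb⟩)
      rw [if_neg h] at this
      exact hρ _ _ this
  · push Not at hw
    have heq : (conj L').solutionSet = (conj L).solutionSet := by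
      ext x
      refine ⟨fun hx => mem_solutionSet_conj.2 fun I hI => ?_, fun hx =>
        mem_solutionSet_conj.2 fun I hI => mem_solutionSet_conj.1 hx I (mem'.1 hI).1⟩
      split_ifs with h
      · obtain ⟨J, hJ, hJw, hle⟩ := hw x hx
        have hIJ : I = J := by
          have hI' : I ∈ L.filter fun I => I.weak := by simp [hI, h]
          have hJ' : J ∈ L.filter fun I => I.weak := by simp [hJ, hJw]
          obtain ⟨K, hK⟩ := List.length_eq_one_iff.1
            (le_antisymm hL (List.length_pos_of_mem hI'))
          rw [hK, List.mem_singleton] at hI' hJ'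
          rw [hI', hJ']
        rw [hIJ]
        exact hle
      · have := mem_solutionSet_conj.1 hx I (mem'.2 ⟨hI, by simpa using h⟩)
        rwa [if_neg h] at this
    obtain ⟨w, hw⟩ := hne
    obtain ⟨ρ, hρ⟩ := key w
    refine ⟨L', ρ, heq, fun I hI => ?_⟩
    have hb := (mem'.1 hI).2
    have := mem_solutionSet_conj.1 (heq ▸ hw) I hI
    simp only [hb] at this ⊢
    exact hρ _ _ (by simpa using this)

/-- A nonempty solution set of an almost open conjunction is stable, in both directions, under
breaking ties by a suitable permutation. -/
lemma Problem.AlmostOpen.exists_perm {C : Problem n} (hC : C.AlmostOpen)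
    (hne : C.solutionSet.Nonempty) :
    ∃ ρ : Equiv.Perm (Fin n), ∀ τ x, Refines τ ρ x →
      (x ∈ C.solutionSet ↔ (fun i => ((τ i : ℕ) : ℝ)) ∈ C.solutionSet) := by
  obtain ⟨L, hCL, hL, -⟩ := hC
  have hCL' : C.solutionSet = (conj L).solutionSet := hCL
  obtain ⟨L', ρ, hL', hρ⟩ := exists_list_and_perm hL (hCL' ▸ hne)
  refine ⟨ρ, fun τ x hr => ?_⟩
  have hτ : Refines τ ρ fun i => ((τ i : ℕ) : ℝ) :=
    Refines.of_forall_lt fun i j hij => .inl (Nat.cast_lt.2 hij)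
  rw [hCL', ← hL', hr.mem_solutionSet_iff hρ, hτ.mem_solutionSet_iff hρ]

/-- A solution set containing a point with distinct coordinates is full-dimensional. -/
lemma dim_solutionSet_eq {C : Problem n} {τ : Equiv.Perm (Fin n)}
    (hτ : (fun i => ((τ i : ℕ) : ℝ)) ∈ C.solutionSet) : dim C.solutionSet = (n : WithBot ℕ) := by
  have hU : IsOpen {y : Fin n → ℝ | ∀ i j, τ i < τ j → y i < y j} := by
    simp only [Set.ofPred_forall]
    exact isOpen_iInter_of_finite fun i => isOpen_iInter_of_finite fun j =>
      isOpen_iInter_of_finite fun _ => isOpen_lt (continuous_apply i) (continuous_apply j)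
  have hsub : {y : Fin n → ℝ | ∀ i j, τ i < τ j → y i < y j} ⊆ C.solutionSet := by
    intro y hy
    have ho : (ofPerm τ).IsOrderOf y := ⟨fun i j hij => by rw [τ.injective hij], hy⟩
    exact (ho.solvedBy_iff C).1 (((isOrderOf_ofPerm τ).solvedBy_iff C).2 hτ)
  have htop : vectorSpan ℝ C.solutionSet = ⊤ := by
    have h := hU.affineSpan_eq_top ⟨fun i => ((τ i : ℕ) : ℝ), fun i j hij => Nat.cast_lt.2 hij⟩
    have h' : affineSpan ℝ C.solutionSet = ⊤ := top_le_iff.1 (h ▸ affineSpan_mono ℝ hsub)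
    rw [← direction_affineSpan, h', AffineSubspace.direction_top]
  rw [dim, if_pos ⟨_, hτ⟩, htop, finrank_top, Module.finrank_fin_fun]

lemma nonempty_of_dim_eq {X : Set (Fin n → ℝ)} {d : ℕ} (h : dim X = (d : WithBot ℕ)) :
    X.Nonempty := by
  by_contra hX
  rw [dim, if_neg hX] at h
  exact WithBot.bot_ne_coe h

/-! ### The allowed configuration -/

/-- The space of the allowed configuration is the part of the solution set in the open cube. -/
lemma space_allow (S : Problem n) :
    (allow S).space = {x | (∀ i, 0 < x i ∧ x i < 1) ∧ x ∈ S.solutionSet} := by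
  ext x
  simp only [PartialComplex.space, Set.mem_iUnion, Set.mem_ofPred_eq, exists_prop]
  constructor
  · rintro ⟨_, ⟨Φ, hΦ, rfl⟩, hx⟩
    rw [Φ.openSimplex_vertices] at hx
    exact ⟨hx.1, (hx.2.solvedBy_iff S).1 hΦ⟩
  · rintro ⟨hx, hS⟩
    obtain ⟨Φ, hΦ⟩ := exists_isOrderOf x
    refine ⟨_, ⟨Φ, (hΦ.solvedBy_iff S).2 hS, rfl⟩, ?_⟩
    rw [Φ.openSimplex_vertices]
    exact ⟨hx, hΦ⟩

/-- The half-open simplices of a disjoint union of almost open polyhedra are collected piece by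
piece, each piece breaking ties by a permutation of its own. -/
theorem partitionable_allow {d : ℕ} {S : Problem n} {C : List (List (Ineq n))}
    (hS : S.Equiv (Problem.disj (C.map conj)))
    (hdisj : C.Pairwise fun L L' => Disjoint (conj L).solutionSet (conj L').solutionSet)
    (hC : ∀ L ∈ C, (conj L).AlmostOpen ∧ dim (conj L).solutionSet = (d : WithBot ℕ)) :
    (allow S).Partitionable d := by
  have memS : ∀ {x}, x ∈ S.solutionSet ↔ ∃ L ∈ C, x ∈ (conj L).solutionSet := by
    intro x
    rw [show S.solutionSet = _ from hS, mem_solutionSet_disj]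
    simp
  have hex : ∀ L, ∃ ρ : Equiv.Perm (Fin n), L ∈ C → ∀ τ x, Refines τ ρ x →
      (x ∈ (conj L).solutionSet ↔ (fun i => ((τ i : ℕ) : ℝ)) ∈ (conj L).solutionSet) := by
    intro L
    by_cases hL : L ∈ C
    · obtain ⟨ρ, hρ⟩ := (hC L hL).1.exists_perm (nonempty_of_dim_eq (hC L hL).2)
      exact ⟨ρ, fun _ => hρ⟩
    · exact ⟨1, fun h => absurd h hL⟩
  choose ρ hρ using hex
  have card : ∀ L ∈ C, ∀ τ : Equiv.Perm (Fin n),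
      (fun i => ((τ i : ℕ) : ℝ)) ∈ (conj L).solutionSet → (ofPerm τ).vertices.card = d + 1 := by
    intro L hL τ hτ
    have h : (n : WithBot ℕ) = d := (dim_solutionSet_eq hτ).symm.trans (hC L hL).2
    rw [card_vertices, ← Nat.cast_injective h]
    rfl
  have face : ∀ L ∈ C, ∀ τ : Equiv.Perm (Fin n),
      (fun i => ((τ i : ℕ) : ℝ)) ∈ (conj L).solutionSet →
        (ofPerm τ).vertices ∈ (allow S).closed.faces := fun L hL τ hτ =>
    (allow S).faces_subset
      ⟨_, ((isOrderOf_ofPerm τ).solvedBy_iff S).2 (memS.2 ⟨L, hL, hτ⟩), rfl⟩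
  refine ⟨?_, {p | ∃ L ∈ C, ∃ τ : Equiv.Perm (Fin n),
    (fun i => ((τ i : ℕ) : ℝ)) ∈ (conj L).solutionSet ∧
      p = (descentVertices τ (ρ L), (ofPerm τ).vertices)}, ?_, ?_, ?_⟩
  · intro s hs
    obtain ⟨Φ, hΦ, rfl⟩ := (allow S).facets_subset hs
    obtain ⟨x, hx⟩ := Φ.nonempty_openSimplex_vertices
    have hx' := hx
    rw [Φ.openSimplex_vertices] at hx'
    obtain ⟨L, hL, hxL⟩ := memS.1 ((hx'.2.solvedBy_iff S).1 hΦ)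
    obtain ⟨τ, hτ⟩ := exists_refines (ρ L) x
    have hτL := (hρ L hL τ x hτ).1 hxL
    have hsub : Φ.vertices ⊆ (ofPerm τ).vertices := by
      refine vertices_subset_of_mem (l := descentVertices τ (ρ L)) hx ?_
      rw [halfOpenSimplex_descentVertices]
      exact ⟨hx'.1, hτ⟩
    rw [← card L hL τ hτL]
    exact congrArg Finset.card (hs.2 (face L hL τ hτL) hsub)
  · rintro _ ⟨L, hL, τ, hτ, rfl⟩
    exact ⟨descentVertices_subset _ _, face L hL τ hτ, card L hL τ hτ⟩
  · rintro _ ⟨L, hL, τ, hτ, rfl⟩ _ ⟨L', hL', τ', hτ', rfl⟩ hne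
    rw [Function.onFun, Set.disjoint_left]
    intro x hx hx'
    simp only [halfOpenSimplex_descentVertices, Set.mem_ofPred_eq] at hx hx'
    by_cases hLL : L = L'
    · subst hLL
      rw [hx.2.unique hx'.2] at hne
      exact hne rfl
    · have : Std.Symm fun M M' : List (Ineq n) =>
          Disjoint (conj M).solutionSet (conj M').solutionSet := ⟨fun _ _ h => h.symm⟩
      exact Set.disjoint_left.1 (hdisj.forall hL hL' hLL)
        ((hρ L hL τ x hx.2).2 hτ) ((hρ L' hL' τ' x hx'.2).2 hτ')
  · rw [space_allow]
    ext x
    simp only [Set.mem_iUnion, Set.mem_ofPred_eq, exists_prop]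
    constructor
    · rintro ⟨_, ⟨L, hL, τ, hτ, rfl⟩, hx⟩
      simp only [halfOpenSimplex_descentVertices, Set.mem_ofPred_eq] at hx
      exact ⟨hx.1, memS.2 ⟨L, hL, (hρ L hL τ x hx.2).2 hτ⟩⟩
    · rintro ⟨hx, hxS⟩
      obtain ⟨L, hL, hxL⟩ := memS.1 hxS
      obtain ⟨τ, hτ⟩ := exists_refines (ρ L) x
      refine ⟨_, ⟨L, hL, τ, (hρ L hL τ x hτ).1 hxL, rfl⟩, ?_⟩
      simp only [halfOpenSimplex_descentVertices, Set.mem_ofPred_eq]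
      exact ⟨hx, hτ⟩

end Scheduling

theorem mainTheorem3 (n d : ℕ) :
    (∀ L : List (Ineq n), (conj L).AlmostOpen →
      dim (conj L).solutionSet = (d : WithBot ℕ) →
      (allow (conj L)).Partitionable d) ∧
    (∀ (S : Problem n) (C : List (List (Ineq n))),
      S.Equiv (Problem.disj (C.map conj)) →
      C.Pairwise (fun L L' => Disjoint (conj L).solutionSet (conj L').solutionSet) →
      (∀ L ∈ C, (conj L).AlmostOpen ∧ dim (conj L).solutionSet = (d : WithBot ℕ)) →
      (allow S).Partitionable d) := by
  refine ⟨fun L hL hd => partitionable_allow (C := [L]) ?_ (List.pairwise_singleton _ _)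
    (by simpa using ⟨hL, hd⟩), fun S C hS hdisj hC => partitionable_allow hS hdisj hC⟩
  ext x
  simp [mem_solutionSet_disj]
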